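/- Let $\mathcal H_A$ and $\mathcal H_B$ be two-dimensional complex Hilbert spaces, let $\mathcal H_E$ be a finite-dimensional complex Hilbert space, and let $\sigma_{ABE}$ be a density operator on $\mathcal H_A\otimes\mathcal H_B\otimes\mathcal H_E$, with reduced operator $\sigma_{AB}=\mathrm{tr}_E(\sigma_{ABE})$. Let $\{|0\rangle_A,|1\rangle_A\}$ and $\{|0\rangle_B,|1\rangle_B\}$ be orthonormal bases of $\mathcal H_A$ and $\mathcal H_B$, write $|x,y\rangle:=|x\rangle_A\otimes|y\rangle_B$, and let $$\sigma_{XYE}=\sum_{x,y\in\{0,1\}}|x\rangle\langle x|\otimes|y\rangle\langle y|\otimes\bigl(\langle x,y|\otimes \mathrm{id}_E\bigr)\,\sigma_{ABE}\,\bigl(|x,y\rangle\otimes \mathrm{id}_E\bigr)$$ be the state obtained by measuring $A$ and $B$ in these bases. Define the Bell basis relative to the measurement bases by $$|\Phi_0\rangle=\tfrac{1}{\sqrt2}(|0,0\rangle+|1,1\rangle),\quad |\Phi_1\rangle=\tfrac{1}{\sqrt2}(|0,0\rangle-|1,1\rangle),\quad |\Phi_2\rangle=\tfrac{1}{\sqrt2}(|0,1\rangle+|1,0\rangle),\quad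 |\Phi_3\rangle=\tfrac{1}{\sqrt2}(|0,1\rangle-|1,0\rangle),$$ and let $\lambda_i:=\langle\Phi_i|\sigma_{AB}|\Phi_i\rangle$ for $i=0,1,2,3$. Then $$H(X|E)-H(X|Y)\;\ge\;1-(\lambda_0+\lambda_1)\,h\Bigl(\frac{\lambda_0}{\lambda_0+\lambda_1}\Bigr)-(\lambda_2+\lambda_3)\,h\Bigl(\frac{\lambda_2}{\lambda_2+\lambda_3}\Bigr)-h(\lambda_0+\lambda_1).$$ Here the entropies on the left are evaluated for $\sigma_{XYE}$, with $H(S|T):=H(\rho_{ST})-H(\rho_T)$ and $H(\rho):=-\mathrm{tr}(\rho\log_2\rho)$ the von Neumann entropy, $h(p):=-p\log_2 p-(1-p)\log_2(1-p)$ is the binary entropy (with $0\log_2 0=0$), and a term $(\lambda_i+\lambda_j)\,h\bigl(\lambda_i/(\lambda_i+\lambda_j)\bigr)$ with $\lambda_i+\lambda_j=0$ is read as $0$. -/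

import Mathlib

open scoped Kronecker ComplexOrder

/-! Finite-dimensional quantum systems. A system with index type `ι` has Hilbert space `ℂ^ι`
(`EuclideanSpace ℂ ι`), and operators on it are matrices `Matrix ι ι ℂ`; the product of the
systems `ι` and `κ` is `ι × κ`. -/

noncomputable section

namespace TwoLevel

/-- Binary Shannon entropy in bits, `h(p) = -p log₂ p - (1-p) log₂ (1-p)`. -/
def h (p : ℝ) : ℝ := Real.binEntropy p / Real.log 2

/-- Density operators: nonnegative operators of trace one. -/
structure IsDensity {ι : Type*} [Fintype ι] (ρ : Matrix ι ι ℂ) : Prop where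
  posSemidef : ρ.PosSemidef
  trace_eq_one : ρ.trace = 1

open Classical in
/-- Von Neumann entropy in bits, `H(ρ) = -tr(ρ log₂ ρ)`, computed from the eigenvalues of the
hermitian matrix `ρ`, with `0 log₂ 0 = 0`. The value for non-hermitian `ρ` is irrelevant. -/
def vonNeumannEntropy {ι : Type*} [Fintype ι] (ρ : Matrix ι ι ℂ) : ℝ :=
  if hρ : ρ.IsHermitian then
    -∑ i, hρ.eigenvalues i * Real.logb 2 (hρ.eigenvalues i)
  else 0

/-- Partial trace over the first factor, `ρ_{ST} ↦ ρ_T`. -/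
def traceFst {S T : Type*} [Fintype S] (ρ : Matrix (S × T) (S × T) ℂ) : Matrix T T ℂ :=
  fun t t' => ∑ s, ρ (s, t) (s, t')

/-- Partial trace over the second factor, `ρ_{ST} ↦ ρ_S`. -/
def traceSnd {S T : Type*} [Fintype T] (ρ : Matrix (S × T) (S × T) ℂ) : Matrix S S ℂ :=
  fun s s' => ∑ t, ρ (s, t) (s', t)

/-- Partial trace over the middle factor, `ρ_{STU} ↦ ρ_{SU}`. -/
def traceMid {S T U : Type*} [Fintype T] (ρ : Matrix ((S × T) × U) ((S × T) × U) ℂ) :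
    Matrix (S × U) (S × U) ℂ :=
  fun p q => ∑ t, ρ ((p.1, t), p.2) ((q.1, t), q.2)

/-- Conditional von Neumann entropy `H(S|T) = H(ρ_{ST}) - H(ρ_T)`. -/
def condEntropy {S T : Type*} [Fintype S] [Fintype T] (ρ : Matrix (S × T) (S × T) ℂ) : ℝ :=
  vonNeumannEntropy ρ - vonNeumannEntropy (traceFst ρ)

/-- A qubit. -/
abbrev Qubit := EuclideanSpace ℂ (Fin 2)

/-- The product vector `u ⊗ v` of two qubit vectors. -/
def tensorVec (u v : Qubit) : Fin 2 × Fin 2 → ℂ := fun p => u p.1 * v p.2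

/-- The operator `|x,y⟩⟨a_x,b_y| ⊗ id_E` belonging to the outcome `(x, y)` of the measurement
of `A` in the basis `a` and of `B` in the basis `b`; the outcome is recorded in
the classical registers `X`, `Y`, with values in `Fin 2`. -/
def measKraus (E : Type*) [DecidableEq E] (a b : OrthonormalBasis (Fin 2) ℂ Qubit)
    (x y : Fin 2) : Matrix ((Fin 2 × Fin 2) × E) ((Fin 2 × Fin 2) × E) ℂ :=
  Matrix.vecMulVec (Pi.single (x, y) 1) (star (tensorVec (a x) (b y))) ⊗ₖ (1 : Matrix E E ℂ)

/-- The state `σ_{XYE}` that results from `σ_{ABE}` when `A` is measured in the orthonormal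
basis `a` and `B` in the orthonormal basis `b`:
`σ_{XYE} = ∑_{x,y} |x,y⟩⟨x,y| ⊗ (⟨a_x,b_y| ⊗ id_E) σ_{ABE} (|a_x,b_y⟩ ⊗ id_E)`. -/
def measuredState {E : Type*} [Fintype E] [DecidableEq E] (a b : OrthonormalBasis (Fin 2) ℂ Qubit)
    (σ : Matrix ((Fin 2 × Fin 2) × E) ((Fin 2 × Fin 2) × E) ℂ) :
    Matrix ((Fin 2 × Fin 2) × E) ((Fin 2 × Fin 2) × E) ℂ :=
  ∑ x, ∑ y, measKraus E a b x y * σ * (measKraus E a b x y).conjTranspose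

/-- The Bell basis relative to the bases `a` of `A` and `b` of `B`. -/
def bell (a b : OrthonormalBasis (Fin 2) ℂ Qubit) : Fin 4 → Fin 2 × Fin 2 → ℂ :=
  let s : ℂ := ((1 / Real.sqrt 2 : ℝ) : ℂ)
  ![s • tensorVec (a 0) (b 0) + s • tensorVec (a 1) (b 1),
    s • tensorVec (a 0) (b 0) - s • tensorVec (a 1) (b 1),
    s • tensorVec (a 0) (b 1) + s • tensorVec (a 1) (b 0),
    s • tensorVec (a 0) (b 1) - s • tensorVec (a 1) (b 0)]

/-- The diagonal values `λ_i = ⟨Φ_i| σ_{AB} |Φ_i⟩` with respect to the Bell basis (which are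
real for hermitian `σ_{AB}`). -/
def bellDiag (a b : OrthonormalBasis (Fin 2) ℂ Qubit)
    (σAB : Matrix (Fin 2 × Fin 2) (Fin 2 × Fin 2) ℂ) (i : Fin 4) : ℝ :=
  (star (bell a b i) ⬝ᵥ (σAB.mulVec (bell a b i))).re

end TwoLevel

end

open Matrix

/-! Purify σ_{ABE} by a system R. The entropies of E and XE equal those of the complementary states:
ρ on ABR, and τ, which is ρ dephased on A. Since τ = (ρ + ZρZ)/2 for the Pauli Z on A, H(X|E) = H(τ)
- H(ρ) is the relative entropy D(ρ‖τ). Discarding R and measuring AB in the Bell basis can only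
decrease it, so H(X|E) ≥ D(λ‖μ). Dephasing A averages λ within the pairs {0,1} and {2,3}, which
gives μ. By the chain rule D(λ‖μ) is 1 minus the two weighted binary entropies. Finally Pr[X = Y] =
λ_0 + λ_1, so H(X|Y) ≤ h(λ_0 + λ_1).

The data processing step is `sum_log_sub_log_le_entropy_sub`. Relative entropy is an integral over s
> 0 of resolvent sums (`sum_mul_log_sub_log_le`). Each of these is bounded below by a quadratic
variational expression (`trace_mul_diagonal_le_sum_resolvent`), and a diagonal trial operator yields
the classical value. The purification is carried out in `sum_log_sub_log_le_condEntropy`. -/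

/-! ### Relative entropy as an integral of resolvents -/

open Filter Topology in
-- The alternative `c = 0` admits terms of weight zero, where `r` or `t` may vanish, as in 0 log 0 =
-- 0.
theorem tendsto_log_add_mul_sub_nhds_zero {c r t : ℝ} (hc : c = 0 ∨ 0 < r ∧ 0 < t) :
    Tendsto (fun s : ℝ => c * (Real.log (t + s * r) - Real.log (1 + s))) (𝓝[>] 0)
      (𝓝 (c * Real.log t)) := by
  rcases hc with rfl | ⟨hr, ht⟩
  · simp
  · have h : ContinuousAt (fun s : ℝ => c * (Real.log (t + s * r) - Real.log (1 + s))) 0 := by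
      refine continuousAt_const.mul (ContinuousAt.sub ?_ ?_)
      · exact ContinuousAt.log (by fun_prop) (by simpa using ht.ne')
      · exact ContinuousAt.log (by fun_prop) (by simp)
    have := h.tendsto
    simp only [zero_mul, add_zero, Real.log_one, sub_zero] at this
    exact this.mono_left nhdsWithin_le_nhds

open Filter Topology in
theorem tendsto_log_add_mul_sub_atTop {c r t : ℝ} (hc : c = 0 ∨ 0 < r ∧ 0 < t) :
    Tendsto (fun s : ℝ => c * (Real.log (t + s * r) - Real.log (1 + s))) atTop
      (𝓝 (c * Real.log r)) := by
  rcases hc with rfl | ⟨hr, ht⟩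
  · simp
  · refine Tendsto.const_mul c ?_
    have h1 : Tendsto (fun s : ℝ => (t - r) / (1 + s) + r) atTop (𝓝 r) := by
      have : Tendsto (fun s : ℝ => (t - r) / (1 + s)) atTop (𝓝 0) :=
        Tendsto.const_div_atTop (tendsto_atTop_add_const_left _ _ tendsto_id) _
      simpa using this.add_const r
    refine ((Real.continuousAt_log hr.ne').tendsto.comp h1).congr' ?_
    filter_upwards [eventually_gt_atTop 0] with s hs
    have hs1 : (0 : ℝ) < 1 + s := by positivity
    have hs2 : (0 : ℝ) < t + s * r := by positivity
    rw [Function.comp_apply, ← Real.log_div hs2.ne' hs1.ne']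
    congr 1
    field_simp
    ring

theorem hasDerivAt_log_add_mul_sub {c r t s : ℝ} (hc : c = 0 ∨ 0 < r ∧ 0 < t) (hs : 0 < s) :
    HasDerivAt (fun s : ℝ => c * (Real.log (t + s * r) - Real.log (1 + s)))
      (c * (r / (t + s * r)) - c * (1 / (1 + s))) s := by
  rcases hc with rfl | ⟨hr, ht⟩
  · simpa using hasDerivAt_const s (0 : ℝ)
  · rw [← mul_sub]
    refine HasDerivAt.const_mul c (HasDerivAt.sub ?_ ?_)
    · refine HasDerivAt.log ?_ (by positivity)
      simpa using ((hasDerivAt_id s).mul_const r).const_add t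
    · refine HasDerivAt.log ?_ (by positivity)
      simpa using (hasDerivAt_id s).const_add 1

open Filter Topology in
/-- An inequality between resolvent sums integrates to one between relative entropies. -/
theorem sum_mul_log_sub_log_le {ι κ : Type*} [Fintype ι] [Fintype κ]
    {c r t : ι → ℝ} {d p q : κ → ℝ}
    (hc : ∀ i, c i = 0 ∨ 0 < r i ∧ 0 < t i) (hd : ∀ k, d k = 0 ∨ 0 < p k ∧ 0 < q k)
    (hsum : ∑ i, c i = ∑ k, d k)
    (h : ∀ s : ℝ, 0 < s →
      ∑ k, d k * (p k / (q k + s * p k)) ≤ ∑ i, c i * (r i / (t i + s * r i))) :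
    ∑ k, d k * (Real.log (p k) - Real.log (q k)) ≤
      ∑ i, c i * (Real.log (r i) - Real.log (t i)) := by
  -- The limits of `f` at 0 and at infinity differ by the difference of the two relative entropies.
  -- Subtracting log(1 + s) keeps each term bounded at infinity.
  let f : ℝ → ℝ := fun s =>
    ∑ i, c i * (Real.log (t i + s * r i) - Real.log (1 + s)) -
      ∑ k, d k * (Real.log (q k + s * p k) - Real.log (1 + s))
  have hf0 : Tendsto f (𝓝[>] 0) (𝓝 (∑ i, c i * Real.log (t i) - ∑ k, d k * Real.log (q k))) :=
    (tendsto_finsetSum _ fun i _ => tendsto_log_add_mul_sub_nhds_zero (hc i)).sub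
      (tendsto_finsetSum _ fun k _ => tendsto_log_add_mul_sub_nhds_zero (hd k))
  have hfi : Tendsto f atTop (𝓝 (∑ i, c i * Real.log (r i) - ∑ k, d k * Real.log (p k))) :=
    (tendsto_finsetSum _ fun i _ => tendsto_log_add_mul_sub_atTop (hc i)).sub
      (tendsto_finsetSum _ fun k _ => tendsto_log_add_mul_sub_atTop (hd k))
  have hder : ∀ s : ℝ, 0 < s → HasDerivAt f
      (∑ i, (c i * (r i / (t i + s * r i)) - c i * (1 / (1 + s))) -
        ∑ k, (d k * (p k / (q k + s * p k)) - d k * (1 / (1 + s)))) s := fun s hs =>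
    (HasDerivAt.fun_sum fun i _ => hasDerivAt_log_add_mul_sub (hc i) hs).sub
      (HasDerivAt.fun_sum fun k _ => hasDerivAt_log_add_mul_sub (hd k) hs)
  have hmono : MonotoneOn f (Set.Ioi 0) := by
    refine monotoneOn_of_deriv_nonneg (convex_Ioi 0)
      (fun s hs => (hder s hs).continuousAt.continuousWithinAt)
      (fun s hs => (hder s (by simpa using hs)).differentiableAt.differentiableWithinAt) ?_
    intro s hs
    have hs' : 0 < s := by simpa using hs
    -- Equal total weights cancel the 1/(1 + s) terms, leaving the difference of the resolvent sums.
    rw [(hder s hs').deriv, Finset.sum_sub_distrib, Finset.sum_sub_distrib, ← Finset.sum_mul,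
      ← Finset.sum_mul, hsum]
    linarith [h s hs']
  have hle : ∀ s : ℝ, 0 < s → f s ≤ ∑ i, c i * Real.log (r i) - ∑ k, d k * Real.log (p k) := by
    intro s hs
    refine ge_of_tendsto hfi ?_
    filter_upwards [eventually_ge_atTop s] with s' hs'
    exact hmono hs (lt_of_lt_of_le hs hs') hs'
  have := le_of_tendsto hf0 (eventually_mem_nhdsWithin.mono hle)
  simp only [mul_sub, Finset.sum_sub_distrib]
  linarith

/-! ### Von Neumann entropy through the characteristic polynomial -/

theorem Matrix.IsHermitian.exists_unitary_diagonal {n : Type*} [Fintype n] [DecidableEq n]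
    {A : Matrix n n ℂ} (hA : A.IsHermitian) :
    ∃ U : Matrix n n ℂ, Uᴴ * U = 1 ∧ U * Uᴴ = 1 ∧
      A = U * diagonal (fun i => (hA.eigenvalues i : ℂ)) * Uᴴ := by
  refine ⟨hA.eigenvectorUnitary, ?_, ?_, ?_⟩
  · exact Unitary.coe_star_mul_self hA.eigenvectorUnitary
  · exact Unitary.coe_mul_star_self hA.eigenvectorUnitary
  · conv_lhs => rw [hA.spectral_theorem]
    rfl

/-- The natural-logarithm entropy as a sum over the roots of the characteristic polynomial. -/
theorem vonNeumannEntropy_mul_log_two {n : Type*} [Fintype n] [DecidableEq n]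
    {A : Matrix n n ℂ} (hA : A.IsHermitian) :
    TwoLevel.vonNeumannEntropy A * Real.log 2 =
      (A.charpoly.roots.map fun z => Real.negMulLog z.re).sum := by
  rw [hA.roots_charpoly_eq_eigenvalues, TwoLevel.vonNeumannEntropy, dif_pos hA]
  have h2 : Real.log 2 ≠ 0 := (Real.log_pos one_lt_two).ne'
  simp only [Multiset.map_map, Function.comp_def, Real.negMulLog, Real.logb]
  rw [neg_mul, Finset.sum_mul, ← Finset.sum_neg_distrib]
  change _ = ∑ i, _
  refine Finset.sum_congr (by congr) fun i _ => ?_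
  simp only [RCLike.ofReal_eq_complex_ofReal, Complex.ofReal_re]
  field_simp
  congr!

theorem vonNeumannEntropy_mul_log_two_eq_sum_eigenvalues {n : Type*} [Fintype n] [DecidableEq n]
    {A : Matrix n n ℂ} (hA : A.IsHermitian) :
    TwoLevel.vonNeumannEntropy A * Real.log 2 = ∑ i, Real.negMulLog (hA.eigenvalues i) := by
  rw [vonNeumannEntropy_mul_log_two hA, hA.roots_charpoly_eq_eigenvalues, Multiset.map_map]
  rfl

theorem vonNeumannEntropy_diagonal_mul_log_two {n : Type*} [Fintype n] [DecidableEq n]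
    (d : n → ℝ) :
    TwoLevel.vonNeumannEntropy (diagonal fun i => (d i : ℂ)) * Real.log 2 =
      ∑ i, Real.negMulLog (d i) := by
  rw [vonNeumannEntropy_mul_log_two
    (isHermitian_diagonal_of_self_adjoint _ (by ext i; simp)), charpoly_diagonal,
    Polynomial.roots_prod _ _ (by simp [Finset.prod_ne_zero_iff, Polynomial.X_sub_C_ne_zero])]
  simp

theorem vonNeumannEntropy_transpose {n : Type*} [Fintype n] {A : Matrix n n ℂ}
    (hA : A.IsHermitian) :
    TwoLevel.vonNeumannEntropy Aᵀ = TwoLevel.vonNeumannEntropy A := by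
  classical
  refine mul_right_cancel₀ (Real.log_pos one_lt_two).ne' ?_
  rw [vonNeumannEntropy_mul_log_two hA, vonNeumannEntropy_mul_log_two hA.transpose,
    charpoly_transpose]

/-- `A Aᴴ` and `Aᴴ A` have the same entropy. -/
theorem vonNeumannEntropy_mul_conjTranspose_comm {m n : Type*} [Fintype m] [Fintype n]
    (A : Matrix m n ℂ) :
    TwoLevel.vonNeumannEntropy (A * Aᴴ) = TwoLevel.vonNeumannEntropy (Aᴴ * A) := by
  classical
  refine mul_right_cancel₀ (Real.log_pos one_lt_two).ne' ?_
  rw [vonNeumannEntropy_mul_log_two (isHermitian_mul_conjTranspose_self A),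
    vonNeumannEntropy_mul_log_two (isHermitian_conjTranspose_mul_self A)]
  -- The two characteristic polynomials agree up to powers of X, and the extra zero roots contribute
  -- `negMulLog 0 = 0`.
  have h := congrArg (fun P : Polynomial ℂ =>
    (P.roots.map fun z => Real.negMulLog z.re).sum) (charpoly_mul_comm' A Aᴴ)
  rw [Polynomial.roots_mul (mul_ne_zero (pow_ne_zero _ Polynomial.X_ne_zero)
      (charpoly_monic _).ne_zero),
    Polynomial.roots_mul (mul_ne_zero (pow_ne_zero _ Polynomial.X_ne_zero)
      (charpoly_monic _).ne_zero)] at h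
  simpa [Polynomial.roots_pow, Multiset.map_nsmul, Multiset.sum_nsmul] using h

/-! ### Data processing for the average over an involution -/

theorem sum_mul_re_mul_star {m n : Type*} [Fintype m] [Fintype n] [DecidableEq m]
    (r : m → ℝ) (A B : Matrix m n ℂ) :
    ∑ i, ∑ j, r i * (A i j * star (B i j)).re =
      (diagonal (fun i => (r i : ℂ)) * (A * Bᴴ)).trace.re := by
  simp only [trace, diag_apply, diagonal_mul, Complex.re_sum, Complex.re_ofReal_mul]
  simp only [mul_apply, Complex.re_sum, conjTranspose_apply, Finset.mul_sum]

theorem sum_mul_re_mul_star' {m n : Type*} [Fintype m] [Fintype n] [DecidableEq n]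
    (t : n → ℝ) (A B : Matrix m n ℂ) :
    ∑ i, ∑ j, t j * (A i j * star (B i j)).re =
      (A * diagonal (fun i => (t i : ℂ)) * Bᴴ).trace.re := by
  have h : ∀ i, (A * diagonal (fun i => (t i : ℂ)) * Bᴴ) i i =
      ∑ j, (t j : ℂ) * (A i j * star (B i j)) := fun i => by
    rw [mul_apply]
    refine Finset.sum_congr rfl fun j _ => ?_
    rw [mul_diagonal, conjTranspose_apply]
    ring
  simp only [trace, diag_apply, h, Complex.re_sum, Complex.re_ofReal_mul]

/-- If `diag t` is the average of `A` and its conjugate by an involution `B`, then `A` and `diag t`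
have the same expectation of `log t`. -/
theorem sum_diag_mul_log_of_average {n : Type*} [Fintype n] [DecidableEq n]
    {A B : Matrix n n ℂ} {t : n → ℝ} (hB : B * B = 1)
    (ht : A + B * A * B = (2 : ℂ) • diagonal (fun i => (t i : ℂ))) (f : ℝ → ℝ) :
    ∑ j, (A j j).re * f (t j) = ∑ j, t j * f (t j) := by
  -- Conjugation by `B` swaps the two summands of the average, so `B` commutes with diag t and hence
  -- with every function of it.
  have hcomm : B * diagonal (fun i => (t i : ℂ)) = diagonal (fun i => (t i : ℂ)) * B := by
    have h : B * (A + B * A * B) = (A + B * A * B) * B := by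
      have h1 : B * (B * A * B) = A * B := by rw [← mul_assoc, ← mul_assoc, hB, one_mul]
      have h2 : B * A * B * B = B * A := by rw [mul_assoc, hB, mul_one]
      rw [mul_add, add_mul, h1, h2, add_comm]
    rw [ht, Matrix.mul_smul, Matrix.smul_mul] at h
    exact smul_right_injective _ (two_ne_zero (α := ℂ)) h
  have hcommf : B * diagonal (fun i => (f (t i) : ℂ)) = diagonal (fun i => (f (t i) : ℂ)) * B := by
    ext i j
    have h := congrFun (congrFun hcomm i) j
    simp only [mul_diagonal, diagonal_mul] at h ⊢
    by_cases hb : B i j = 0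
    · simp [hb]
    · have : t j = t i := by
        rw [mul_comm] at h
        exact_mod_cast mul_right_cancel₀ hb h
      rw [this, mul_comm]
  have htr : (B * A * B * diagonal (fun i => (f (t i) : ℂ))).trace =
      (A * diagonal (fun i => (f (t i) : ℂ))).trace := by
    rw [mul_assoc, hcommf, trace_mul_comm, mul_assoc, ← mul_assoc B B A, hB, one_mul,
      trace_mul_comm]
  have h := congrArg (fun M => (M * diagonal (fun i => (f (t i) : ℂ))).trace) ht
  simp only [add_mul, trace_add, htr, Matrix.smul_mul, trace_smul, diagonal_mul_diagonal] at h
  rw [smul_eq_mul, ← two_mul] at h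
  have h' := congrArg Complex.re (mul_left_cancel₀ (two_ne_zero (α := ℂ)) h)
  simpa [trace, mul_diagonal, Complex.re_sum, mul_comm] using h'

/-- `B * A * B` is positive, so A ≤ 2T. This supplies the support condition: where T has diagonal
entry 0, so does A. -/
theorem diag_re_le_two_mul_of_average {n : Type*} [Fintype n]
    {A B T : Matrix n n ℂ} (hA : A.PosSemidef) (hB : Bᴴ = B)
    (ht : A + B * A * B = (2 : ℂ) • T) (j : n) : (A j j).re ≤ 2 * (T j j).re := by
  have h : (B * A * B).PosSemidef := by
    simpa [hB] using hA.mul_mul_conjTranspose_same B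
  have h1 := congrArg Complex.re (congrFun (congrFun ht j) j)
  have h2 := (Complex.le_def.1 (h.diag_nonneg (i := j))).1
  simp only [Matrix.add_apply, Matrix.smul_apply, Complex.add_re, smul_eq_mul, Complex.mul_re, Complex.re_ofNat,
    Complex.im_ofNat, zero_mul, sub_zero, Complex.zero_re] at h1 h2
  linarith

/-- Completing the square in `y`; the maximum is at y = rc/(t + sr). The case r = 0 is split off
because the denominator may then vanish. -/
theorem two_mul_re_sub_le_mul_div {r t s : ℝ} (hr : 0 ≤ r) (ht : 0 ≤ t) (hs : 0 < s)
    (c y : ℂ) :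
    2 * (r * (y * star c).re) - (t * (y * star y).re + s * (r * (y * star y).re)) ≤
      Complex.normSq c * r * (r / (t + s * r)) := by
  have hy : (y * star y).re = Complex.normSq y := by
    rw [Complex.star_def, Complex.mul_conj, Complex.ofReal_re]
  rw [hy]
  rcases hr.eq_or_lt with rfl | hr
  · simpa using mul_nonneg ht (Complex.normSq_nonneg y)
  have hd : 0 < t + s * r := by positivity
  rw [← mul_div_assoc, le_div_iff₀ hd, Complex.star_def]
  simp only [Complex.normSq_apply, Complex.mul_re, Complex.conj_re, Complex.conj_im]
  nlinarith [sq_nonneg (r * c.re - (t + s * r) * y.re), sq_nonneg (r * c.im - (t + s * r) * y.im)]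

/-- Variational bound on the resolvent sum of `ρ = U diag(r) Uᴴ` and `τ = V diag(t) Vᴴ`. -/
theorem trace_mul_diagonal_le_sum_resolvent {n : Type*} [Fintype n] [DecidableEq n]
    {U V : Matrix n n ℂ} {r t : n → ℝ} (hU : U * Uᴴ = 1) (hV : V * Vᴴ = 1)
    (hr : ∀ i, 0 ≤ r i) (ht : ∀ i, 0 ≤ t i) {s : ℝ} (hs : 0 < s) (x : n → ℝ) :
    2 * ∑ m, x m * ((U * diagonal (fun i => (r i : ℂ)) * Uᴴ) m m).re -
      ((∑ m, x m ^ 2 * ((V * diagonal (fun i => (t i : ℂ)) * Vᴴ) m m).re) +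
        s * ∑ m, x m ^ 2 * ((U * diagonal (fun i => (r i : ℂ)) * Uᴴ) m m).re) ≤
      ∑ i, ∑ j, Complex.normSq ((Uᴴ * V) i j) * r i * (r i / (t j + s * r i)) := by
  set X : Matrix n n ℂ := diagonal (fun m => (x m : ℂ)) with hX
  set R : Matrix n n ℂ := diagonal (fun i => (r i : ℂ)) with hR
  set T : Matrix n n ℂ := diagonal (fun i => (t i : ℂ)) with hT
  have hXH : Xᴴ = X := by rw [hX, diagonal_conjTranspose]; congr 1; ext i; simp
  have hXX : X * X = diagonal (fun m => ((x m ^ 2 : ℝ) : ℂ)) := by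
    rw [hX, diagonal_mul_diagonal]; congr 1; ext i; push_cast; ring
  have htr : ∀ (y : n → ℝ) (M : Matrix n n ℂ),
      (diagonal (fun m => (y m : ℂ)) * M).trace.re = ∑ m, y m * (M m m).re := fun y M => by
    simp only [trace, diag_apply, diagonal_mul, Complex.re_sum, Complex.re_ofReal_mul]
  -- The trial operator X enters through its matrix elements between the two eigenbases. The three
  -- traces `h1`, `h2`, `h3` turn the entrywise bound, with y = (UᴴXV)_{ij} and c = (UᴴV)_{ij}, into
  -- diagonal expectations.
  have h1 : (R * ((Uᴴ * X * V) * (Uᴴ * V)ᴴ)).trace.re = ∑ m, x m * ((U * R * Uᴴ) m m).re := by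
    have : R * ((Uᴴ * X * V) * (Uᴴ * V)ᴴ) = R * (Uᴴ * (X * (V * Vᴴ) * U)) := by
      simp only [conjTranspose_mul, conjTranspose_conjTranspose, mul_assoc]
    rw [this, hV, mul_one, ← htr x, ← hX, ← mul_assoc, ← mul_assoc, trace_mul_comm,
      ← mul_assoc, ← mul_assoc, trace_mul_comm]
  have h2 : (R * ((Uᴴ * X * V) * (Uᴴ * X * V)ᴴ)).trace.re =
      ∑ m, x m ^ 2 * ((U * R * Uᴴ) m m).re := by
    have : R * ((Uᴴ * X * V) * (Uᴴ * X * V)ᴴ) = R * (Uᴴ * (X * (V * Vᴴ) * X * U)) := by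
      simp only [conjTranspose_mul, conjTranspose_conjTranspose, mul_assoc, hXH]
    rw [this, hV, mul_one, ← htr, ← hXX, ← mul_assoc, ← mul_assoc, trace_mul_comm,
      ← mul_assoc, ← mul_assoc, trace_mul_comm, ← mul_assoc X, trace_mul_comm (X * _),
      ← mul_assoc X X, ← mul_assoc U R]
  have h3 : ((Uᴴ * X * V) * T * (Uᴴ * X * V)ᴴ).trace.re =
      ∑ m, x m ^ 2 * ((V * T * Vᴴ) m m).re := by
    have : (Uᴴ * X * V) * T * (Uᴴ * X * V)ᴴ = Uᴴ * (X * (V * T * Vᴴ) * X * U) := by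
      simp only [conjTranspose_mul, conjTranspose_conjTranspose, mul_assoc, hXH]
    rw [this, trace_mul_comm, mul_assoc, hU, mul_one, trace_mul_comm, ← mul_assoc, hXX, htr]
  rw [← h1, ← h2, ← h3, hR, hT, ← sum_mul_re_mul_star, ← sum_mul_re_mul_star,
    ← sum_mul_re_mul_star', Finset.mul_sum, Finset.mul_sum, ← Finset.sum_add_distrib,
    ← Finset.sum_sub_distrib]
  refine Finset.sum_le_sum fun i _ => ?_
  rw [Finset.mul_sum, Finset.mul_sum, ← Finset.sum_add_distrib, ← Finset.sum_sub_distrib]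
  exact Finset.sum_le_sum fun j _ => two_mul_re_sub_le_mul_div (hr i) (ht j) hs _ _

theorem re_traceSnd_apply {κ R : Type*} [Fintype R] (M : Matrix (κ × R) (κ × R) ℂ) (k : κ) :
    (TwoLevel.traceSnd M k k).re = ∑ i, (M (k, i) (k, i)).re := by
  simp [TwoLevel.traceSnd]

/-- Data processing: averaging `ρ` with its conjugate by a hermitian unitary raises the entropy by
at least the relative entropy of the diagonals of the reduced operators. -/
theorem sum_log_sub_log_le_entropy_sub {κ R : Type*} [Fintype κ] [Fintype R] [DecidableEq κ]
    [DecidableEq R] {ρ τ Z : Matrix (κ × R) (κ × R) ℂ} (hρ : ρ.PosSemidef) (hZ : Zᴴ = Z)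
    (hZZ : Z * Z = 1) (hτ : ρ + Z * ρ * Z = (2 : ℂ) • τ) :
    ∑ k, (TwoLevel.traceSnd ρ k k).re *
      (Real.log (TwoLevel.traceSnd ρ k k).re - Real.log (TwoLevel.traceSnd τ k k).re) ≤
      (TwoLevel.vonNeumannEntropy τ - TwoLevel.vonNeumannEntropy ρ) * Real.log 2 := by
  have hτp : τ.PosSemidef := by
    have h : τ = (1 / 2 : ℂ) • (ρ + Z * ρ * Z) := by rw [hτ, smul_smul]; norm_num
    rw [h]
    refine PosSemidef.smul (hρ.add ?_) (by positivity)
    simpa [hZ] using hρ.mul_mul_conjTranspose_same Z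
  obtain ⟨U, hU, hU', hρU⟩ := Matrix.IsHermitian.exists_unitary_diagonal hρ.1
  obtain ⟨V, hV, hV', hτV⟩ := Matrix.IsHermitian.exists_unitary_diagonal hτp.1
  set r := hρ.1.eigenvalues with hr
  set t := hτp.1.eigenvalues with ht
  have hr0 : ∀ i, 0 ≤ r i := hρ.eigenvalues_nonneg
  have ht0 : ∀ i, 0 ≤ t i := hτp.eigenvalues_nonneg
  set p := fun k => (TwoLevel.traceSnd ρ k k).re with hp
  set q := fun k => (TwoLevel.traceSnd τ k k).re with hq
  set A := Vᴴ * ρ * V with hA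
  set B := Vᴴ * Z * V with hB
  set w := fun i j => Complex.normSq ((Uᴴ * V) i j) with hw
  have hAp : A.PosSemidef := by simpa using hρ.conjTranspose_mul_mul_same V
  have hBH : Bᴴ = B := by
    simp only [hB, conjTranspose_mul, conjTranspose_conjTranspose, hZ, mul_assoc]
  have hBB : B * B = 1 := by
    have : B * B = Vᴴ * Z * (V * Vᴴ) * Z * V := by simp only [hB, mul_assoc]
    rw [this, hV', mul_one, mul_assoc Vᴴ, hZZ, mul_one, hV]
  have havg : A + B * A * B = (2 : ℂ) • diagonal (fun i => (t i : ℂ)) := by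
    have h1 : B * A * B = Vᴴ * (Z * ((V * Vᴴ) * ρ * (V * Vᴴ)) * Z) * V := by
      simp only [hA, hB, mul_assoc]
    rw [h1, hV', one_mul, mul_one, hA, ← add_mul, ← mul_add, hτ, Matrix.mul_smul,
      Matrix.smul_mul, hτV]
    congr 1
    have : Vᴴ * (V * diagonal (fun i => (t i : ℂ)) * Vᴴ) * V =
      (Vᴴ * V) * diagonal (fun i => (t i : ℂ)) * (Vᴴ * V) := by simp only [mul_assoc]
    rw [this, hV, one_mul, mul_one]
  have hAdiag : ∀ j, (A j j).re = ∑ i, w i j * r i := by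
    intro j
    have : A = (Uᴴ * V)ᴴ * diagonal (fun i => (r i : ℂ)) * (Uᴴ * V) := by
      rw [hA, hρU]
      simp only [conjTranspose_mul, conjTranspose_conjTranspose, mul_assoc]
    rw [this, mul_apply, Complex.re_sum]
    refine Finset.sum_congr rfl fun i _ => ?_
    rw [mul_diagonal, conjTranspose_apply, Complex.star_def, mul_right_comm,
      ← Complex.normSq_eq_conj_mul_self,
      ← Complex.ofReal_mul, Complex.ofReal_re]
  have hAle : ∀ j, (A j j).re ≤ 2 * t j := fun j => by
    simpa using diag_re_le_two_mul_of_average hAp hBH havg j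
  have hwsum : ∀ i, ∑ j, w i j = 1 := by
    intro i
    have h : ((Uᴴ * V) * (Uᴴ * V)ᴴ) i i = 1 := by
      have : (Uᴴ * V) * (Uᴴ * V)ᴴ = Uᴴ * (V * Vᴴ) * U := by
        simp only [conjTranspose_mul, conjTranspose_conjTranspose, mul_assoc]
      rw [this, hV', mul_one, hU, one_apply_eq]
    have h' := congrArg Complex.re h
    rw [mul_apply, Complex.re_sum, Complex.one_re] at h'
    rw [← h']
    refine Finset.sum_congr rfl fun j _ => ?_
    rw [conjTranspose_apply, Complex.star_def, Complex.mul_conj, Complex.ofReal_re]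
  have hw0 : ∀ i j, 0 ≤ w i j := fun i j => Complex.normSq_nonneg _
  have hp0 : ∀ k, 0 ≤ p k := fun k => by
    simp only [hp, re_traceSnd_apply]
    exact Finset.sum_nonneg fun i _ => (Complex.le_def.1 hρ.diag_nonneg).1
  have hpq : ∀ k, p k ≤ 2 * q k := fun k => by
    simp only [hp, hq, re_traceSnd_apply, Finset.mul_sum]
    exact Finset.sum_le_sum fun i _ => diag_re_le_two_mul_of_average hρ hZ hτ _
  -- The weights w_{ij} r_i, with w_{ij} the squared overlaps of the eigenvectors of ρ and τ,
  -- express D(ρ‖τ) as a sum of scalar logarithms.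
  have key := sum_mul_log_sub_log_le (ι := (κ × R) × (κ × R)) (κ := κ)
    (c := fun x => w x.1 x.2 * r x.1) (r := fun x => r x.1) (t := fun x => t x.2)
    (d := p) (p := p) (q := q) ?_ ?_ ?_ ?_
  · refine key.trans (le_of_eq ?_)
    simp only [mul_sub, Finset.sum_sub_distrib]
    have h1 : ∑ x : (κ × R) × (κ × R), w x.1 x.2 * r x.1 * Real.log (r x.1) =
        ∑ i, r i * Real.log (r i) := by
      rw [Fintype.sum_prod_type]
      simp only [← Finset.sum_mul, hwsum, one_mul]
    have h2 : ∑ x : (κ × R) × (κ × R), w x.1 x.2 * r x.1 * Real.log (t x.2) =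
        ∑ j, t j * Real.log (t j) := by
      rw [Fintype.sum_prod_type_right]
      simp only [← Finset.sum_mul]
      simp only [← hAdiag]
      exact sum_diag_mul_log_of_average hBB havg _
    rw [h1, h2, sub_mul,
      vonNeumannEntropy_mul_log_two_eq_sum_eigenvalues hτp.1,
      vonNeumannEntropy_mul_log_two_eq_sum_eigenvalues hρ.1]
    simp only [Real.negMulLog, neg_mul, Finset.sum_neg_distrib]
    ring
  · rintro ⟨i, j⟩
    by_cases h : w i j * r i = 0
    · exact Or.inl h
    · have hpos : 0 < w i j * r i := lt_of_le_of_ne (mul_nonneg (hw0 i j) (hr0 i)) (Ne.symm h)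
      refine Or.inr ⟨lt_of_le_of_ne (hr0 i) (Ne.symm (right_ne_zero_of_mul h)), ?_⟩
      have h1 : w i j * r i ≤ (A j j).re := by
        rw [hAdiag]
        exact Finset.single_le_sum (f := fun i => w i j * r i)
          (fun i _ => mul_nonneg (hw0 i j) (hr0 i)) (Finset.mem_univ i)
      have h2 := hAle j
      change 0 < t j
      linarith
  · intro k
    rcases (hp0 k).eq_or_lt with h | h
    · exact Or.inl h.symm
    · exact Or.inr ⟨h, by linarith [hpq k]⟩
  · rw [Fintype.sum_prod_type]
    simp only [← Finset.sum_mul, hwsum, one_mul]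
    have h1 := congrArg Complex.re hρ.1.trace_eq_sum_eigenvalues
    simp only [trace, diag_apply, Complex.re_sum, Fintype.sum_prod_type] at h1
    simp only [hp, re_traceSnd_apply]
    rw [h1, Fintype.sum_prod_type]
    rfl
  · intro s hs
    rw [Fintype.sum_prod_type]
    -- The trial value x = p/(q + sp), constant along `R`, maximizes 2xp - x²(q + sp), with maximum
    -- p²/(q + sp).
    have h := trace_mul_diagonal_le_sum_resolvent hU' hV' hr0 ht0 hs
      (fun m : κ × R => p m.1 / (q m.1 + s * p m.1))
    rw [← hρU, ← hτV] at h
    refine le_trans (le_of_eq ?_) h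
    simp only [Fintype.sum_prod_type, ← Finset.mul_sum, ← re_traceSnd_apply]
    rw [Finset.mul_sum, Finset.mul_sum, ← Finset.sum_add_distrib, ← Finset.sum_sub_distrib]
    refine Finset.sum_congr rfl fun k _ => ?_
    change p k * (p k / (q k + s * p k)) = 2 * (p k / (q k + s * p k) * p k) -
      ((p k / (q k + s * p k)) ^ 2 * q k + s * ((p k / (q k + s * p k)) ^ 2 * p k))
    rcases (hp0 k).eq_or_lt with h | h
    · simp [← h]
    · have : 0 < q k + s * p k := by
        have := hpq k
        nlinarith [mul_pos hs h]
      field_simp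
      ring

/-! ### Classical entropies of two bits and of the Bell distribution -/

/-- This is log x ≤ x - 1 at x = yw/d, scaled by d. -/
theorem mul_log_add_log_sub_log_le {d y w : ℝ} (hd : 0 ≤ d) (hy : d ≤ y) (hw : d ≤ w) :
    d * (Real.log y + Real.log w - Real.log d) ≤ y * w - d := by
  rcases hd.eq_or_lt with rfl | hd
  · simpa using mul_nonneg hy hw
  have hy' : 0 < y := hd.trans_le hy
  have hw' : 0 < w := hd.trans_le hw
  rw [← Real.log_mul hy'.ne' hw'.ne', ← Real.log_div (by positivity) hd.ne']
  have h := mul_le_mul_of_nonneg_left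
    (Real.log_le_sub_one_of_pos (show 0 < y * w / d by positivity)) hd.le
  refine h.trans (le_of_eq ?_)
  field_simp

/-- The classical bound `H(X|Y) ≤ h(Pr[X = Y])` for two bits. -/
theorem sum_negMulLog_sub_le_binEntropy {d : Fin 2 × Fin 2 → ℝ} (hd : ∀ i, 0 ≤ d i)
    (hsum : ∑ i, d i = 1) :
    ∑ i, Real.negMulLog (d i) - ∑ y, Real.negMulLog (∑ x, d (x, y)) ≤
      Real.binEntropy (d (0, 0) + d (1, 1)) := by
  simp only [Fintype.sum_prod_type, Fin.sum_univ_two] at hsum ⊢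
  have h00 := hd (0, 0)
  have h01 := hd (0, 1)
  have h10 := hd (1, 0)
  have h11 := hd (1, 1)
  generalize d (0, 0) = p at *
  generalize d (0, 1) = q at *
  generalize d (1, 0) = r at *
  generalize d (1, 1) = s at *
  have hW : 1 - (p + s) = q + r := by linarith
  rw [Real.binEntropy_eq_negMulLog_add_negMulLog_one_sub, hW]
  -- Gibbs' inequality against the product of the law of Y and the law of X ⊕ Y: in each term the
  -- first factor is a marginal of Y and the second is Pr[X = Y] or Pr[X ≠ Y]. The four products sum
  -- to 1.
  have e1 := mul_log_add_log_sub_log_le h00 (show p ≤ p + r by linarith)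
    (show p ≤ p + s by linarith)
  have e2 := mul_log_add_log_sub_log_le h01 (show q ≤ q + s by linarith)
    (show q ≤ q + r by linarith)
  have e3 := mul_log_add_log_sub_log_le h10 (show r ≤ p + r by linarith)
    (show r ≤ q + r by linarith)
  have e4 := mul_log_add_log_sub_log_le h11 (show s ≤ q + s by linarith)
    (show s ≤ p + s by linarith)
  have hprod : (p + r) * (p + s) + (q + s) * (q + r) + (p + r) * (q + r) + (q + s) * (p + s) =
      (p + q + (r + s)) ^ 2 := by ring
  rw [hsum] at hprod
  simp only [Real.negMulLog]
  nlinarith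

/-- The grouping rule for entropy. For x = y = 0 the prefactor makes the left side 0, whatever the
quotient. -/
theorem add_mul_binEntropy_div {x y : ℝ} (hx : 0 ≤ x) (hy : 0 ≤ y) :
    (x + y) * Real.binEntropy (x / (x + y)) =
      Real.negMulLog x + Real.negMulLog y - Real.negMulLog (x + y) := by
  rcases hx.eq_or_lt with rfl | hx
  · rcases hy.eq_or_lt with rfl | hy <;> simp
  rcases hy.eq_or_lt with rfl | hy
  · simp [hx.ne']
  have h : 1 - x / (x + y) = y / (x + y) := by field_simp; ring
  rw [Real.binEntropy_eq_negMulLog_add_negMulLog_one_sub, h]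
  simp only [Real.negMulLog]
  rw [Real.log_div hx.ne' (by positivity), Real.log_div hy.ne' (by positivity)]
  field_simp
  ring

theorem add_mul_log_half {x y : ℝ} :
    (x + y) * Real.log ((x + y) / 2) = -Real.negMulLog (x + y) - (x + y) * Real.log 2 := by
  by_cases h : x + y = 0
  · simp [h]
  · rw [Real.log_div h two_ne_zero, Real.negMulLog]
    ring

/-- The chain rule splits the entropy of λ into the entropy of the pair label and the entropies
within pairs. The label entropy cancels in D(λ‖μ), and the halves in μ contribute log 2. -/
theorem sum_log_sub_log_half_eq {l : Fin 4 → ℝ} (hl : ∀ k, 0 ≤ l k) (hsum : ∑ k, l k = 1) :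
    l 0 * (Real.log (l 0) - Real.log ((l 0 + l 1) / 2)) +
      l 1 * (Real.log (l 1) - Real.log ((l 0 + l 1) / 2)) +
      l 2 * (Real.log (l 2) - Real.log ((l 2 + l 3) / 2)) +
      l 3 * (Real.log (l 3) - Real.log ((l 2 + l 3) / 2)) - Real.binEntropy (l 0 + l 1) =
    (1 - (l 0 + l 1) * TwoLevel.h (l 0 / (l 0 + l 1))
      - (l 2 + l 3) * TwoLevel.h (l 2 / (l 2 + l 3)) - TwoLevel.h (l 0 + l 1)) * Real.log 2 := by
  have h2 : Real.log 2 ≠ 0 := (Real.log_pos one_lt_two).ne'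
  have e1 := add_mul_binEntropy_div (hl 0) (hl 1)
  have e2 := add_mul_binEntropy_div (hl 2) (hl 3)
  have e3 := add_mul_log_half (x := l 0) (y := l 1)
  have e4 := add_mul_log_half (x := l 2) (y := l 3)
  have hR : (1 - (l 0 + l 1) * TwoLevel.h (l 0 / (l 0 + l 1))
      - (l 2 + l 3) * TwoLevel.h (l 2 / (l 2 + l 3)) - TwoLevel.h (l 0 + l 1)) * Real.log 2 =
      Real.log 2 - (l 0 + l 1) * Real.binEntropy (l 0 / (l 0 + l 1)) -
        (l 2 + l 3) * Real.binEntropy (l 2 / (l 2 + l 3)) - Real.binEntropy (l 0 + l 1) := by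
    simp only [TwoLevel.h]
    field_simp
  simp only [Fin.sum_univ_four] at hsum
  have hW : 1 - (l 0 + l 1) = l 2 + l 3 := by linarith
  rw [hR, e1, e2, Real.binEntropy_eq_negMulLog_add_negMulLog_one_sub, hW]
  simp only [Real.negMulLog] at *
  linear_combination -e3 - e4 + Real.log 2 * hsum

/-! The Bell basis in coordinates. -/

/-- The coefficients of the Bell vectors with respect to the product basis. -/
noncomputable def bellCoeff : Matrix (Fin 4) (Fin 2 × Fin 2) ℂ :=
  let s : ℂ := ((1 / Real.sqrt 2 : ℝ) : ℂ)
  fun k p => (![!![s, 0; 0, s], !![s, 0; 0, -s], !![0, s; s, 0], !![0, s; -s, 0]] :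
    Fin 4 → Matrix (Fin 2) (Fin 2) ℂ) k p.1 p.2

theorem ofReal_one_div_sqrt_two_mul_self :
    ((1 / Real.sqrt 2 : ℝ) : ℂ) * ((1 / Real.sqrt 2 : ℝ) : ℂ) = 1 / 2 := by
  rw [← Complex.ofReal_mul, div_mul_div_comm, Real.mul_self_sqrt (by norm_num)]
  norm_num

theorem star_bellCoeff (k : Fin 4) (p : Fin 2 × Fin 2) :
    star (bellCoeff k p) = bellCoeff k p := by
  obtain ⟨x, y⟩ := p
  fin_cases k <;> fin_cases x <;> fin_cases y <;> simp [bellCoeff]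

theorem bellCoeff_mul_conjTranspose : bellCoeff * bellCoeffᴴ = 1 := by
  have h := ofReal_one_div_sqrt_two_mul_self
  ext i j
  simp only [mul_apply, conjTranspose_apply, star_bellCoeff, Fintype.sum_prod_type,
    Fin.sum_univ_two]
  simp only [bellCoeff]
  generalize ((1 / Real.sqrt 2 : ℝ) : ℂ) = s at *
  fin_cases i <;> fin_cases j <;> simp [h] <;> norm_num

theorem bellCoeff_conjTranspose_mul : bellCoeffᴴ * bellCoeff = 1 := by
  have h := ofReal_one_div_sqrt_two_mul_self
  ext ⟨i, i'⟩ ⟨j, j'⟩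
  simp only [mul_apply, conjTranspose_apply, star_bellCoeff, Fin.sum_univ_four]
  simp only [bellCoeff]
  generalize ((1 / Real.sqrt 2 : ℝ) : ℂ) = s at *
  fin_cases i <;> fin_cases i' <;> fin_cases j <;> fin_cases j' <;> simp [h] <;> norm_num

/-- Coordinates with respect to the product of the bases `a` and `b`. -/
noncomputable def prodBasisCoord (a b : OrthonormalBasis (Fin 2) ℂ TwoLevel.Qubit) :
    Matrix (Fin 2 × Fin 2) (Fin 2 × Fin 2) ℂ :=
  fun i p => star (TwoLevel.tensorVec (a i.1) (b i.2) p)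

theorem bellCoeff_mul_prodBasisCoord (a b : OrthonormalBasis (Fin 2) ℂ TwoLevel.Qubit)
    (k : Fin 4) (p : Fin 2 × Fin 2) :
    (bellCoeff * prodBasisCoord a b) k p = star (TwoLevel.bell a b k p) := by
  rw [mul_apply]
  simp only [Fintype.sum_prod_type, Fin.sum_univ_two, bellCoeff, prodBasisCoord, TwoLevel.bell]
  generalize hs : ((1 / Real.sqrt 2 : ℝ) : ℂ) = s at *
  have hstar : (starRingEnd ℂ) s = s := by rw [← hs]; exact Complex.conj_ofReal _
  fin_cases k <;> simp [hstar, sub_eq_add_neg]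

theorem bellDiag_eq (a b : OrthonormalBasis (Fin 2) ℂ TwoLevel.Qubit)
    (T : Matrix (Fin 2 × Fin 2) (Fin 2 × Fin 2) ℂ) (k : Fin 4) :
    TwoLevel.bellDiag a b T k =
      ((bellCoeff * (prodBasisCoord a b * T * (prodBasisCoord a b)ᴴ) * bellCoeffᴴ) k k).re := by
  have h : bellCoeff * (prodBasisCoord a b * T * (prodBasisCoord a b)ᴴ) * bellCoeffᴴ =
      (bellCoeff * prodBasisCoord a b) * (T * (bellCoeff * prodBasisCoord a b)ᴴ) := by
    simp only [conjTranspose_mul, Matrix.mul_assoc]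
  rw [h, mul_apply, TwoLevel.bellDiag]
  simp only [dotProduct, mulVec, mul_apply (M := T), conjTranspose_apply,
    bellCoeff_mul_prodBasisCoord, star_star, Pi.star_apply]

/-! ### Measurement as a change of basis followed by dephasing -/

/-- Partial trace of a local conjugation. -/
theorem traceSnd_kronecker_one_conj {S S' R : Type*} [Fintype S] [Fintype R] [DecidableEq R]
    (F : Matrix S' S ℂ) (M : Matrix (S × R) (S × R) ℂ) :
    TwoLevel.traceSnd ((F ⊗ₖ (1 : Matrix R R ℂ)) * M * (F ⊗ₖ (1 : Matrix R R ℂ))ᴴ) =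
      F * TwoLevel.traceSnd M * Fᴴ := by
  ext i j
  simp only [TwoLevel.traceSnd, mul_apply, conjTranspose_apply, kroneckerMap_apply,
    Fintype.sum_prod_type, one_apply, mul_ite, ite_mul, mul_one, mul_zero, zero_mul, apply_ite star,
    star_zero, Finset.sum_ite_eq, Finset.mem_univ, if_true, Finset.sum_mul,
    Finset.mul_sum]
  rw [Finset.sum_comm]
  refine Finset.sum_congr rfl fun s _ => ?_
  rw [Finset.sum_comm]

/-- The state after a projective measurement of the first factor in the standard basis. -/
def pinchFst {S R : Type*} [DecidableEq S] (M : Matrix (S × R) (S × R) ℂ) :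
    Matrix (S × R) (S × R) ℂ :=
  fun i j => if i.1 = j.1 then M i j else 0

/-- This removes `a` and `b` from the problem: after a local unitary both measurements are in the
standard basis. -/
theorem measuredState_eq {E : Type*} [Fintype E] [DecidableEq E]
    (a b : OrthonormalBasis (Fin 2) ℂ TwoLevel.Qubit)
    (σ : Matrix ((Fin 2 × Fin 2) × E) ((Fin 2 × Fin 2) × E) ℂ) :
    TwoLevel.measuredState a b σ = pinchFst ((prodBasisCoord a b ⊗ₖ (1 : Matrix E E ℂ)) * σ *
      (prodBasisCoord a b ⊗ₖ (1 : Matrix E E ℂ))ᴴ) := by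
  have hK : ∀ x y, TwoLevel.measKraus E a b x y =
      diagonal (fun m : (Fin 2 × Fin 2) × E => if m.1 = (x, y) then (1 : ℂ) else 0) *
        (prodBasisCoord a b ⊗ₖ (1 : Matrix E E ℂ)) := by
    intro x y
    ext i j
    simp only [TwoLevel.measKraus, diagonal_mul, kroneckerMap_apply, vecMulVec_apply,
      prodBasisCoord, Pi.star_apply, Pi.single_apply]
    by_cases h : i.1 = (x, y) <;> simp [h]
  set M := (prodBasisCoord a b ⊗ₖ (1 : Matrix E E ℂ)) * σ *
      (prodBasisCoord a b ⊗ₖ (1 : Matrix E E ℂ))ᴴ with hM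
  have hKM : ∀ x y, TwoLevel.measKraus E a b x y * σ * (TwoLevel.measKraus E a b x y)ᴴ =
      diagonal (fun m : (Fin 2 × Fin 2) × E => if m.1 = (x, y) then (1 : ℂ) else 0) * M *
      diagonal (fun m : (Fin 2 × Fin 2) × E => if m.1 = (x, y) then (1 : ℂ) else 0) := by
    intro x y
    have hd : (diagonal (fun m : (Fin 2 × Fin 2) × E => if m.1 = (x, y) then (1 : ℂ) else 0))ᴴ =
        diagonal (fun m => if m.1 = (x, y) then (1 : ℂ) else 0) := by
      rw [diagonal_conjTranspose]
      congr 1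
      ext m
      simp [apply_ite]
    rw [hK, conjTranspose_mul, hd, hM]
    simp only [mul_assoc]
  ext i j
  rw [TwoLevel.measuredState]
  simp only [hKM, Matrix.sum_apply, mul_diagonal, diagonal_mul, pinchFst]
  rw [← Fintype.sum_prod_type' (f := fun x y => (if i.1 = (x, y) then (1 : ℂ) else 0) * M i j *
    (if j.1 = (x, y) then (1 : ℂ) else 0))]
  simp only [Prod.mk.eta, ite_mul, one_mul, zero_mul, mul_ite, mul_one, mul_zero]
  rw [Finset.sum_ite_eq]
  simp

theorem condEntropy_pinchFst_traceSnd_le {E : Type*} [Fintype E]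
    {σ : Matrix ((Fin 2 × Fin 2) × E) ((Fin 2 × Fin 2) × E) ℂ} (hσ : TwoLevel.IsDensity σ) :
    TwoLevel.condEntropy (TwoLevel.traceSnd (pinchFst σ)) * Real.log 2 ≤
      Real.binEntropy ((TwoLevel.traceSnd σ (0, 0) (0, 0)).re +
        (TwoLevel.traceSnd σ (1, 1) (1, 1)).re) := by
  set d : Fin 2 × Fin 2 → ℝ := fun i => (TwoLevel.traceSnd σ i i).re with hd
  have him : ∀ i, TwoLevel.traceSnd σ i i = (d i : ℂ) := by
    intro i
    refine Complex.ext rfl ?_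
    rw [Complex.ofReal_im]
    simp only [TwoLevel.traceSnd, Complex.im_sum]
    exact Finset.sum_eq_zero fun e _ => (Complex.le_def.1 hσ.posSemidef.diag_nonneg).2.symm
  have hXY : TwoLevel.traceSnd (pinchFst σ) = diagonal (fun i => (d i : ℂ)) := by
    ext i j
    by_cases h : i = j
    · subst h
      rw [diagonal_apply_eq, ← him]
      simp [TwoLevel.traceSnd, pinchFst]
    · rw [diagonal_apply_ne _ h]
      simp [TwoLevel.traceSnd, pinchFst, h]
  have hY : TwoLevel.traceFst (diagonal (fun i => (d i : ℂ))) =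
      diagonal (fun y => ((∑ x, d (x, y) : ℝ) : ℂ)) := by
    ext i j
    by_cases h : i = j
    · subst h
      simp [TwoLevel.traceFst]
    · simp [TwoLevel.traceFst, h]
  rw [hXY, TwoLevel.condEntropy, hY, sub_mul, vonNeumannEntropy_diagonal_mul_log_two,
    vonNeumannEntropy_diagonal_mul_log_two]
  refine sum_negMulLog_sub_le_binEntropy (fun i => ?_) ?_
  · rw [hd]
    simp only [re_traceSnd_apply]
    exact Finset.sum_nonneg fun e _ => (Complex.le_def.1 hσ.posSemidef.diag_nonneg).1
  · have h := congrArg Complex.re hσ.trace_eq_one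
    simp only [trace, diag_apply, Complex.re_sum, Fintype.sum_prod_type, Complex.one_re] at h
    simp only [hd, re_traceSnd_apply, Fintype.sum_prod_type]
    exact h

/-! ### Purification and the entropy of X given E -/

open scoped MatrixOrder in
theorem Matrix.PosSemidef.exists_eq_mul_conjTranspose {n : Type*} [Fintype n]
    {A : Matrix n n ℂ} (hA : A.PosSemidef) : ∃ B : Matrix n n ℂ, A = B * Bᴴ := by
  classical
  obtain ⟨B, hB⟩ := CStarAlgebra.nonneg_iff_eq_star_mul_self.mp hA.nonneg
  exact ⟨Bᴴ, by rw [hB, conjTranspose_conjTranspose]; rfl⟩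

/-- Lower bound on the entropy of the first bit given `E`. -/
theorem sum_log_sub_log_le_condEntropy {E κ : Type*} [Fintype E] [Fintype κ] [DecidableEq κ]
    {σ : Matrix ((Fin 2 × Fin 2) × E) ((Fin 2 × Fin 2) × E) ℂ} (hσ : σ.PosSemidef)
    {F : Matrix κ (Fin 2 × Fin 2) ℂ} (hF : F * Fᴴ = 1) (hF' : Fᴴ * F = 1) :
    ∑ k, ((F * TwoLevel.traceSnd σ * Fᴴ) k k).re *
      (Real.log ((F * TwoLevel.traceSnd σ * Fᴴ) k k).re -
        Real.log ((F * pinchFst (TwoLevel.traceSnd σ) * Fᴴ) k k).re) ≤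
      TwoLevel.condEntropy (TwoLevel.traceMid (pinchFst σ)) * Real.log 2 := by
  classical
  obtain ⟨N, hN⟩ := hσ.exists_eq_mul_conjTranspose
  let R := (Fin 2 × Fin 2) × E
  -- `N` holds the amplitudes of a purification on ABE and R. `C` regroups them as ABR against E;
  -- `D` also places a coherent copy of A beside E, in the register X.
  let C : Matrix ((Fin 2 × Fin 2) × R) E ℂ := fun i e => N (i.1, e) i.2
  let D : Matrix ((Fin 2 × Fin 2) × R) (Fin 2 × E) ℂ :=
    fun i p => if i.1.1 = p.1 then C i p.2 else 0
  have hCa : ∀ i e, C i e = N (i.1, e) i.2 := fun _ _ => rfl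
  have hDa : ∀ i p, D i p = if i.1.1 = p.1 then C i p.2 else 0 := fun _ _ => rfl
  -- Φ passes to the basis `F` on AB, so that the diagonals of reduced operators are the measured
  -- values. `A` below is the Pauli Z on the first qubit.
  let Φ : Matrix (κ × R) ((Fin 2 × Fin 2) × R) ℂ := F ⊗ₖ (1 : Matrix R R ℂ)
  let A : Matrix ((Fin 2 × Fin 2) × R) ((Fin 2 × Fin 2) × R) ℂ :=
    diagonal fun i => if i.1.1 = 0 then 1 else -1
  have hΦ : Φ * Φᴴ = 1 := by
    simp only [Φ, conjTranspose_kronecker, ← mul_kronecker_mul, hF, conjTranspose_one, Matrix.mul_one,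
      one_kronecker_one]
  have hΦ' : Φᴴ * Φ = 1 := by
    simp only [Φ, conjTranspose_kronecker, ← mul_kronecker_mul, hF', conjTranspose_one, Matrix.mul_one,
      one_kronecker_one]
  have hA : Aᴴ = A := by
    simp only [A, diagonal_conjTranspose]
    congr 1
    ext i
    by_cases h : i.1.1 = 0 <;> simp [h]
  have hAA : A * A = 1 := by
    simp only [A, diagonal_mul_diagonal]
    rw [← diagonal_one]
    congr 1
    ext i
    by_cases h : i.1.1 = 0 <;> simp [h]
  have hDD : ∀ i j, (D * Dᴴ) i j = if i.1.1 = j.1.1 then (C * Cᴴ) i j else 0 := by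
    intro i j
    simp only [mul_apply, hDa, conjTranspose_apply, Fintype.sum_prod_type]
    by_cases h : i.1.1 = j.1.1
    · simp [h]
    · rw [if_neg h]
      refine Finset.sum_eq_zero fun x _ => Finset.sum_eq_zero fun e _ => ?_
      by_cases h' : i.1.1 = x
      · have : j.1.1 ≠ x := fun h'' => h (h'.trans h''.symm)
        simp [this]
      · simp [h']
  have hCA : C * Cᴴ + A * (C * Cᴴ) * A = (2 : ℂ) • (D * Dᴴ) := by
    ext i j
    rw [Matrix.smul_apply, hDD, Matrix.add_apply]
    simp only [A, mul_diagonal, diagonal_mul]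
    have h2 : ∀ x : Fin 2, x = 0 ∨ x = 1 := by decide
    rcases h2 i.1.1 with h | h <;> rcases h2 j.1.1 with h' | h' <;> simp [h, h', two_mul]
  have hCE : Cᴴ * C = (TwoLevel.traceFst (TwoLevel.traceMid (pinchFst σ)))ᵀ := by
    ext e e'
    simp only [mul_apply, conjTranspose_apply, transpose_apply, TwoLevel.traceFst,
      TwoLevel.traceMid, pinchFst, if_true, hN, hCa]
    rw [Fintype.sum_prod_type, Fintype.sum_prod_type]
    simp only [mul_comm]
    rfl
  -- `pinchFst σ` dephases both qubits, but after B is traced out only the dephasing of the first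
  -- one matters.
  have hDE : Dᴴ * D = (TwoLevel.traceMid (pinchFst σ))ᵀ := by
    ext ⟨x, e⟩ ⟨x', e'⟩
    simp only [mul_apply, conjTranspose_apply, transpose_apply,
      TwoLevel.traceMid, pinchFst, hN, hCa, hDa, Prod.mk.injEq, and_true]
    rw [Fintype.sum_prod_type, Fintype.sum_prod_type]
    by_cases h : x' = x
    · subst h
      rw [Finset.sum_eq_single x']
      · simp only [if_true, mul_comm]
        rfl
      · intro b _ hb
        simp [hb]
      · simp
    · simp only [h, if_false, Finset.sum_const_zero]
      refine Finset.sum_eq_zero fun z _ => Finset.sum_eq_zero fun y _ =>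
        Finset.sum_eq_zero fun r _ => ?_
      by_cases h' : z = x
      · have : z ≠ x' := fun h'' => h (h''.symm.trans h')
        simp [this]
      · simp [h']
  have hS : ∀ {m : Type _} [Fintype m] (G : Matrix ((Fin 2 × Fin 2) × R) m ℂ),
      TwoLevel.vonNeumannEntropy (Φ * (G * Gᴴ) * Φᴴ) = TwoLevel.vonNeumannEntropy (Gᴴ * G) := by
    intro m _ G
    have h1 : Φ * (G * Gᴴ) * Φᴴ = (Φ * G) * (Φ * G)ᴴ := by
      simp only [conjTranspose_mul, Matrix.mul_assoc]
    have h2 : (Φ * G)ᴴ * (Φ * G) = Gᴴ * ((Φᴴ * Φ) * G) := by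
      simp only [conjTranspose_mul, Matrix.mul_assoc]
    rw [h1, vonNeumannEntropy_mul_conjTranspose_comm, h2, hΦ', Matrix.one_mul]
  have hC : TwoLevel.traceSnd (C * Cᴴ) = TwoLevel.traceSnd σ := by
    ext i j
    simp only [TwoLevel.traceSnd, mul_apply, conjTranspose_apply, hN, hCa]
    rw [Finset.sum_comm]
  -- On AB alone `pinchFst` has B as its second factor, so here it dephases only A.
  have hD : TwoLevel.traceSnd (D * Dᴴ) = pinchFst (TwoLevel.traceSnd σ) := by
    rw [← hC]
    ext i j
    simp only [TwoLevel.traceSnd, pinchFst, hDD]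
    by_cases h : i.1 = j.1 <;> simp [h]
  have hZconj : ∀ X Y : Matrix ((Fin 2 × Fin 2) × R) ((Fin 2 × Fin 2) × R) ℂ,
      (Φ * X * Φᴴ) * (Φ * Y * Φᴴ) = Φ * (X * Y) * Φᴴ := by
    intro X Y
    have : (Φ * X * Φᴴ) * (Φ * Y * Φᴴ) = Φ * X * ((Φᴴ * Φ) * Y) * Φᴴ := by
      simp only [Matrix.mul_assoc]
    rw [this, hΦ', Matrix.one_mul, Matrix.mul_assoc Φ]
  have key := sum_log_sub_log_le_entropy_sub (ρ := Φ * (C * Cᴴ) * Φᴴ) (τ := Φ * (D * Dᴴ) * Φᴴ)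
    (Z := Φ * A * Φᴴ) ((posSemidef_self_mul_conjTranspose C).mul_mul_conjTranspose_same Φ)
    (by simp only [conjTranspose_mul, conjTranspose_conjTranspose, hA, Matrix.mul_assoc])
    (by rw [hZconj, hAA, Matrix.mul_one, hΦ])
    (by rw [hZconj, hZconj, ← Matrix.add_mul, ← Matrix.mul_add, hCA, Matrix.mul_smul, Matrix.smul_mul])
  rw [hS, hS, hCE, hDE, traceSnd_kronecker_one_conj, traceSnd_kronecker_one_conj, hC, hD] at key
  have hE : (TwoLevel.traceFst (TwoLevel.traceMid (pinchFst σ)))ᵀ.IsHermitian := by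
    rw [← hCE]; exact isHermitian_conjTranspose_mul_self C
  have hXE : (TwoLevel.traceMid (pinchFst σ))ᵀ.IsHermitian := by
    rw [← hDE]; exact isHermitian_conjTranspose_mul_self D
  rw [← vonNeumannEntropy_transpose hE, ← vonNeumannEntropy_transpose hXE, transpose_transpose,
    transpose_transpose] at key
  exact key

/-! ### Bell diagonals and the final estimate -/

/-- Dephasing A removes the coherence between the two product vectors in a Bell vector, so the sign
no longer matters and both members of a pair get the same value. -/
theorem bellCoeff_conj_pinch_diag (T : Matrix (Fin 2 × Fin 2) (Fin 2 × Fin 2) ℂ) (k : Fin 4) :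
    (bellCoeff * pinchFst T * bellCoeffᴴ) k k =
      ![(T (0, 0) (0, 0) + T (1, 1) (1, 1)) / 2, (T (0, 0) (0, 0) + T (1, 1) (1, 1)) / 2,
        (T (0, 1) (0, 1) + T (1, 0) (1, 0)) / 2, (T (0, 1) (0, 1) + T (1, 0) (1, 0)) / 2] k := by
  have h := ofReal_one_div_sqrt_two_mul_self
  simp only [mul_apply, conjTranspose_apply, star_bellCoeff, Fintype.sum_prod_type,
    Fin.sum_univ_two]
  simp only [bellCoeff, pinchFst]
  generalize ((1 / Real.sqrt 2 : ℝ) : ℂ) = s at *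
  fin_cases k <;> simp
  · linear_combination (T (0, 0) (0, 0) + T (1, 1) (1, 1)) * h
  · linear_combination (T (0, 0) (0, 0) + T (1, 1) (1, 1)) * h
  · linear_combination (T (0, 1) (0, 1) + T (1, 0) (1, 0)) * h
  · linear_combination (T (0, 1) (0, 1) + T (1, 0) (1, 0)) * h

/-- Each pair of Bell vectors spans the same plane as its two product vectors; the sums are Pr[X =
Y] and Pr[X ≠ Y]. -/
theorem bellCoeff_conj_diag_add (T : Matrix (Fin 2 × Fin 2) (Fin 2 × Fin 2) ℂ) :
    (bellCoeff * T * bellCoeffᴴ) 0 0 + (bellCoeff * T * bellCoeffᴴ) 1 1 =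
      T (0, 0) (0, 0) + T (1, 1) (1, 1) ∧
    (bellCoeff * T * bellCoeffᴴ) 2 2 + (bellCoeff * T * bellCoeffᴴ) 3 3 =
      T (0, 1) (0, 1) + T (1, 0) (1, 0) := by
  have h := ofReal_one_div_sqrt_two_mul_self
  simp only [mul_apply, conjTranspose_apply, star_bellCoeff, Fintype.sum_prod_type,
    Fin.sum_univ_two]
  simp only [bellCoeff]
  generalize ((1 / Real.sqrt 2 : ℝ) : ℂ) = s at *
  constructor
  · simp
    linear_combination 2 * (T (0, 0) (0, 0) + T (1, 1) (1, 1)) * h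
  · simp
    linear_combination 2 * (T (0, 1) (0, 1) + T (1, 0) (1, 0)) * h

theorem prodBasisCoord_conjTranspose_mul (a b : OrthonormalBasis (Fin 2) ℂ TwoLevel.Qubit) :
    (prodBasisCoord a b)ᴴ * prodBasisCoord a b = 1 := by
  have hrow : prodBasisCoord a b * (prodBasisCoord a b)ᴴ = 1 := by
    ext ⟨x, y⟩ ⟨x', y'⟩
    have ha := orthonormal_iff_ite.1 a.orthonormal x x'
    have hb := orthonormal_iff_ite.1 b.orthonormal y y'
    simp only [PiLp.inner_apply, Fin.sum_univ_two, RCLike.inner_apply] at ha hb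
    simp only [mul_apply, conjTranspose_apply, prodBasisCoord, TwoLevel.tensorVec,
      Fintype.sum_prod_type, Fin.sum_univ_two, star_star, star_mul', one_apply, Prod.mk.injEq]
    have := congrArg₂ (· * ·) ha hb
    simp only [ite_mul, one_mul, zero_mul, ← ite_and] at this
    rw [← this]
    simp only [Complex.star_def]
    ring
  exact mul_eq_one_comm.1 hrow

theorem mainTheorem12 {E : Type*} [Fintype E] [DecidableEq E]
    (a b : OrthonormalBasis (Fin 2) ℂ TwoLevel.Qubit)
    (σABE : Matrix ((Fin 2 × Fin 2) × E) ((Fin 2 × Fin 2) × E) ℂ)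
    (hσ : TwoLevel.IsDensity σABE)
    (l : Fin 4 → ℝ) (hl : l = TwoLevel.bellDiag a b (TwoLevel.traceSnd σABE))
    (σXYE : Matrix ((Fin 2 × Fin 2) × E) ((Fin 2 × Fin 2) × E) ℂ)
    (hXYE : σXYE = TwoLevel.measuredState a b σABE) :
    TwoLevel.condEntropy (TwoLevel.traceMid σXYE) - TwoLevel.condEntropy (TwoLevel.traceSnd σXYE)
      ≥ 1 - (l 0 + l 1) * TwoLevel.h (l 0 / (l 0 + l 1))
          - (l 2 + l 3) * TwoLevel.h (l 2 / (l 2 + l 3))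
          - TwoLevel.h (l 0 + l 1) := by
  set σ := (prodBasisCoord a b ⊗ₖ (1 : Matrix E E ℂ)) * σABE *
    (prodBasisCoord a b ⊗ₖ (1 : Matrix E E ℂ))ᴴ with hσdef
  have hdens : TwoLevel.IsDensity σ := by
    refine ⟨hσ.posSemidef.mul_mul_conjTranspose_same _, ?_⟩
    rw [hσdef, trace_mul_comm, ← mul_assoc, conjTranspose_kronecker, ← mul_kronecker_mul,
      prodBasisCoord_conjTranspose_mul, conjTranspose_one, mul_one, one_kronecker_one, one_mul,
      hσ.trace_eq_one]
  set T := TwoLevel.traceSnd σ with hT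
  have hlT : ∀ k, ((bellCoeff * T * bellCoeffᴴ) k k).re = l k := by
    intro k
    rw [hl, bellDiag_eq, hT, hσdef, traceSnd_kronecker_one_conj]
  have hTtr : (T (0, 0) (0, 0)).re + (T (0, 1) (0, 1)).re +
      ((T (1, 0) (1, 0)).re + (T (1, 1) (1, 1)).re) = 1 := by
    have h := congrArg Complex.re hdens.trace_eq_one
    simp only [trace, diag_apply, Fintype.sum_prod_type, Fin.sum_univ_two, Complex.add_re,
      Complex.re_sum, Complex.one_re] at h
    simpa only [hT, re_traceSnd_apply] using h
  obtain ⟨h01, h23⟩ := bellCoeff_conj_diag_add T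
  replace h01 := congrArg Complex.re h01
  replace h23 := congrArg Complex.re h23
  rw [Complex.add_re, Complex.add_re, hlT, hlT] at h01 h23
  have hpos : ∀ k, 0 ≤ l k := by
    intro k
    rw [← hlT, hT, ← traceSnd_kronecker_one_conj, re_traceSnd_apply]
    exact Finset.sum_nonneg fun i _ =>
      (Complex.le_def.1 (hdens.posSemidef.mul_mul_conjTranspose_same _).diag_nonneg).1
  have hsum : ∑ k, l k = 1 := by
    rw [Fin.sum_univ_four]
    linarith
  have hXE := sum_log_sub_log_le_condEntropy hdens.posSemidef bellCoeff_mul_conjTranspose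
    bellCoeff_conjTranspose_mul
  have hXY := condEntropy_pinchFst_traceSnd_le hdens
  rw [← hT] at hXE hXY
  simp only [hlT, bellCoeff_conj_pinch_diag, Fin.sum_univ_four] at hXE
  simp only [cons_val, Complex.div_ofNat_re, Complex.add_re, ← h01, ← h23] at hXE
  rw [← h01] at hXY
  have hfin := sum_log_sub_log_half_eq hpos hsum
  rw [hXYE, measuredState_eq, ← hσdef]
  -- The bounds above are in natural logarithms; multiplying by log 2 converts from bits.
  refine le_of_mul_le_mul_right ?_ (Real.log_pos one_lt_two)
  rw [← hfin, sub_mul]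
  linarith
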